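/- Let $\gamma\ge 1$, $\mu>0$, $k>0$, and let $h(\rho)=\ln\rho$ if $\gamma=1$ and $h(\rho)=\frac{\gamma}{\gamma-1}\rho^{\gamma-1}$ if $\gamma>1$. Suppose that the end states $P^\pm,u^\pm\in\mathbb R$ and the speed $s\in\mathbb R$ satisfy the Rankine–Hugoniot conditions $$s\big((P^+)^2-(P^-)^2\big)=(P^+)^2u^+-(P^-)^2u^-,$$ $$s(u^+-u^-)=\Big(\tfrac{(u^+)^2}{2}+h((P^+)^2)\Big)-\Big(\tfrac{(u^-)^2}{2}+h((P^-)^2)\Big).$$ Put $A=(s-u^\pm)(P^\pm)^2$ and $B=su^\pm-\frac{(u^\pm)^2}{2}-h((P^\pm)^2)$ (by the conditions above, both choices of sign give the same values), and, for $P>0$, $$f(P)=\Big(\tfrac12\Big(\tfrac{A^2}{P^4}-s^2\Big)+h(P^2)+B\Big)P .$$ Consider, in the phase space $\{(P,Q): P>0\}$, the planar profile system $$P'=Q,\qquad Q'=\frac{f(P)}{k^2}-\frac{2s\mu}{k^2}\,Q. \tag{$*$}$$ A heteroclinic orbit of $(*)$ connecting $(P^-,0)$ to $(P^+,0)$ is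 a solution $(P,Q)$ of $(*)$ defined on all of $\mathbb R$, with $P>0$, that converges to the equilibrium $(P^-,0)$ as $y\to-\infty$ and to the different equilibrium $(P^+,0)$ as $y\to+\infty$. (i) If $s>0$ and $0<P^+<P^-$, then $(*)$ has a heteroclinic orbit connecting $(P^-,0)$ to $(P^+,0)$. If in addition $\frac{s\mu}{k}<\sqrt{-f'(P^+)}$, then every such heteroclinic orbit is non-monotone, that is, $y\mapsto P(y)$ is neither nondecreasing nor nonincreasing on $\mathbb R$; moreover it is oscillatory near $(P^+,0)$: for every $Y\in\mathbb R$ there are $y_1,y_2\ge Y$ with $P(y_1)>P^+$ and $P(y_2)<P^+$. (ii) If $s<0$ and $0<P^-<P^+$, then $(*)$ has a heteroclinic orbit connecting $(P^-,0)$ to $(P^+,0)$. If in addition $-\frac{s\mu}{k}<\sqrt{-f'(P^-)}$, then every such heteroclinic orbit is non-monotone, that is, $y\mapsto P(y)$ is neither nondecreasing nor nonincreasing on $\mathbb R$; moreover it is oscillatory near $(P^-,0)$: for every $Y\in\mathbb R$ there are $y_1,y_2\le Y$ with $P(y_1)>P^-$ and $P(y_2)<P^-$. -/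

import Mathlib

open Filter Topology

noncomputable section

namespace QHD

/-- The enthalpy `h` of the pressure law `p(ρ) = ρ ^ γ`, for `γ ≥ 1` and `ρ > 0`. -/
def enthalpy (γ ρ : ℝ) : ℝ :=
  if γ = 1 then Real.log ρ else γ / (γ - 1) * ρ ^ (γ - 1)

/-- The Rankine–Hugoniot conditions of `ρ_t + (ρ u)_x = 0`, `u_t + (u² / 2 + h(ρ))_x = 0`, for a
jump with speed `s` from the left state `(ρ, u) = (Pm ^ 2, um)` to the right state
`(Pp ^ 2, up)`. -/
structure RankineHugoniot (γ s Pm um Pp up : ℝ) : Prop where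
  mass : s * (Pp ^ 2 - Pm ^ 2) = Pp ^ 2 * up - Pm ^ 2 * um
  momentum : s * (up - um) =
    (up ^ 2 / 2 + enthalpy γ (Pp ^ 2)) - (um ^ 2 / 2 + enthalpy γ (Pm ^ 2))

/-- The integration constant `A = (s - u) P ^ 2` computed at an end state `(P, u)`. -/
def constA (s P u : ℝ) : ℝ := (s - u) * P ^ 2

/-- The integration constant `B = s u - u ^ 2 / 2 - h (P ^ 2)` computed at an end state
`(P, u)`. -/
def constB (γ s P u : ℝ) : ℝ := s * u - u ^ 2 / 2 - enthalpy γ (P ^ 2)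

/-- Under the Rankine–Hugoniot conditions both end states give the same `A`. -/
theorem RankineHugoniot.constA_eq {γ s Pm um Pp up : ℝ}
    (h : RankineHugoniot γ s Pm um Pp up) : constA s Pm um = constA s Pp up := by
  have := h.mass
  unfold constA
  linarith

/-- Under the Rankine–Hugoniot conditions both end states give the same `B`. -/
theorem RankineHugoniot.constB_eq {γ s Pm um Pp up : ℝ}
    (h : RankineHugoniot γ s Pm um Pp up) : constB γ s Pm um = constB γ s Pp up := by
  have := h.momentum
  unfold constB
  linarith

/-- `f(P) = ((A² / P⁴ - s²) / 2 + h(P²) + B) P`, with `A` and `B` the integration constants of the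
end state `(P₀, u₀)`. -/
def f (γ s P₀ u₀ : ℝ) (P : ℝ) : ℝ :=
  ((constA s P₀ u₀ ^ 2 / P ^ 4 - s ^ 2) / 2 + enthalpy γ (P ^ 2) + constB γ s P₀ u₀) * P

/-- The vector field of the planar profile system
`P' = Q`, `Q' = f(P) / k² - (2 s μ / k²) Q`. -/
def profileField (γ μ k s P₀ u₀ : ℝ) (z : ℝ × ℝ) : ℝ × ℝ :=
  (z.2, f γ s P₀ u₀ z.1 / k ^ 2 - 2 * s * μ / k ^ 2 * z.2)

/-- `z` parametrizes a heteroclinic orbit of the autonomous system `z' = X z` with phase space `D`,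
connecting the equilibrium `a` (as `y → -∞`) to the different equilibrium `b` (as `y → +∞`). -/
structure IsHeteroclinic (X : ℝ × ℝ → ℝ × ℝ) (D : Set (ℝ × ℝ)) (a b : ℝ × ℝ)
    (z : ℝ → ℝ × ℝ) : Prop where
  ne : a ≠ b
  left_mem : a ∈ D
  right_mem : b ∈ D
  left_equilibrium : X a = 0
  right_equilibrium : X b = 0
  mem : ∀ y : ℝ, z y ∈ D
  hasDerivAt : ∀ y : ℝ, HasDerivAt z (X (z y)) y
  tendsto_left : Tendsto z atBot (𝓝 a)
  tendsto_right : Tendsto z atTop (𝓝 b)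

/-- `z = (P, Q)` is a heteroclinic orbit of the profile system, in the phase space `P > 0`,
connecting `(Pm, 0)` to `(Pp, 0)`. -/
def IsHeteroclinicProfile (γ μ k s Pm um Pp : ℝ) (z : ℝ → ℝ × ℝ) : Prop :=
  IsHeteroclinic (profileField γ μ k s Pm um) {w | 0 < w.1} (Pm, 0) (Pp, 0) z

/-- The function `g` is neither nondecreasing nor nonincreasing on `ℝ`. -/
def NonMonotone (g : ℝ → ℝ) : Prop := ¬ Monotone g ∧ ¬ Antitone g

/-- `g` oscillates around the value `c` along the filter `l` (`l = atTop` or `l = atBot`):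
arbitrarily far out along `l` it takes values above `c` and values below `c`. -/
def OscillatesAround (g : ℝ → ℝ) (c : ℝ) (l : Filter ℝ) : Prop :=
  (∃ᶠ y in l, c < g y) ∧ (∃ᶠ y in l, g y < c)

end QHD

end

/-! With F = f/k² and ν = 2sμ/k² the system reads P'' = F(P) - νP': a particle in the potential V(x)
= ∫_x^b F, losing the energy Q²/2 + V at rate νQ². Let a < b be the two end states. As a function of
log P, f(P)/P is strictly convex (`QHD.f_sign`), so f > 0 on (0, a) and f < 0 on (a, b): a is the
bottom of a well with rim b, and the A²/P³ term raises an infinite barrier at P = 0 (`QHD.le_f`).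

For ν > 0 the connection runs from b to a. Particles released at rest ever closer to b take ever
longer to reach a fixed line P = p; compactness of the arrival points yields a point whose whole
backward orbit stays in p ≤ P ≤ b, and LaSalle's principle (`tendsto_of_unique_constant_energy`)
makes that orbit emanate from (b, 0). No linearization at b is needed. Forward in time its negative
energy keeps it between barrier and rim, and LaSalle's principle sends it to (a, 0). For s < 0 time
is reversed.

If P - a eventually kept one sign, v = ±e^{νt/2}(P - a) ≥ 0 would satisfy v'' ≤ -δ²v, with δ > 0 by
the bound on ν. Sturm comparison (`eq_zero_of_sturm`) forces v = 0 eventually, and uniqueness makes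
the orbit constant. So P oscillates, and a monotone function cannot take values on both sides of its
limit. -/

/-! ### Global flow of a Lipschitz vector field -/

section LipschitzFlow

open Set Metric
open scoped NNReal

variable {E : Type*} [NormedAddCommGroup E] [NormedSpace ℝ E]

/-- Two solutions of a Lipschitz autonomous equation on a symmetric interval which agree at one
point agree on the whole interval. -/
theorem LipschitzWith.eqOn_Ioo_of_hasDerivAt {v : E → E} {K : ℝ≥0} (hv : LipschitzWith K v)
    {f g : ℝ → E} {a b t₀ : ℝ} (ht₀ : t₀ ∈ Ioo a b)
    (hf : ∀ t ∈ Ioo a b, HasDerivAt f (v (f t)) t)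
    (hg : ∀ t ∈ Ioo a b, HasDerivAt g (v (g t)) t) (h : f t₀ = g t₀) :
    EqOn f g (Ioo a b) :=
  ODE_solution_unique_of_mem_Ioo (v := fun _ => v) (s := fun _ => univ) (K := K)
    (fun _ _ => hv.lipschitzOnWith) ht₀ (fun t ht => ⟨hf t ht, mem_univ _⟩)
    (fun t ht => ⟨hg t ht, mem_univ _⟩) h

/-- Existence time of the solutions of a Lipschitz autonomous equation, independent of the
initial value. -/
theorem LipschitzWith.exists_local_solution [CompleteSpace E] {v : E → E} {K : ℝ≥0}
    (hv : LipschitzWith K v) (x : E) :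
    ∃ γ : ℝ → E, γ 0 = x ∧
      ∀ t ∈ Ioo (-(1 / (1 + K) : ℝ)) (1 / (1 + K)), HasDerivAt γ (v (γ t)) t := by
  set ε : ℝ := 1 / (1 + K) with hε
  have hε0 : 0 < ε := by positivity
  -- On the ball of radius ‖v x‖ + 1 the field is bounded by ‖v x‖ + K(‖v x‖ + 1) ≤ (1 + K)(‖v x‖ +
  -- 1), so the time 1/(1 + K) suffices for every x.
  have hP : IsPicardLindelof (fun _ : ℝ => v) (tmin := -ε) (tmax := ε)
      ⟨0, by constructor <;> linarith⟩ x (‖v x‖₊ + 1) 0 (‖v x‖₊ + K * (‖v x‖₊ + 1)) K := by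
    refine IsPicardLindelof.of_time_independent (fun y hy => ?_) hv.lipschitzOnWith ?_
    · have h1 := hv.dist_le_mul y x
      rw [mem_closedBall] at hy
      have h2 : ‖v y‖ ≤ ‖v x‖ + dist (v y) (v x) := by
        rw [dist_eq_norm]; exact norm_le_norm_add_norm_sub' _ _
      have h3 : (K : ℝ) * dist y x ≤ K * (‖v x‖₊ + 1 : ℝ≥0) := by gcongr
      push_cast at h3 ⊢
      linarith [coe_nnnorm (v x)]
    · have h0 : (0 : ℝ) ≤ ‖v x‖ := norm_nonneg _
      have h1 : (0 : ℝ) ≤ K := K.2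
      push_cast
      simp only [sub_zero, zero_sub, neg_neg, max_self]
      rw [hε, mul_one_div, div_le_iff₀ (by positivity)]
      nlinarith
  obtain ⟨γ, h0, hγ⟩ := hP.exists_eq_forall_mem_Icc_hasDerivWithinAt₀
  exact ⟨γ, h0, fun t ht =>
    (hγ t (Ioo_subset_Icc_self ht)).hasDerivAt (Icc_mem_nhds ht.1 ht.2)⟩

/-- Restarting at times ±T/2 gains T/2 on each side. By uniqueness both restarted pieces agree with
γ on (-T/2, T/2), so they can be glued at 0. -/
theorem LipschitzWith.exists_solution_extend {v : E → E} {K : ℝ≥0} (hv : LipschitzWith K v)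
    {T : ℝ} (hT : 0 < T)
    (h : ∀ x, ∃ γ : ℝ → E, γ 0 = x ∧ ∀ t ∈ Ioo (-T) T, HasDerivAt γ (v (γ t)) t) (x : E) :
    ∃ γ : ℝ → E, γ 0 = x ∧
      ∀ t ∈ Ioo (-(3 / 2 * T)) (3 / 2 * T), HasDerivAt γ (v (γ t)) t := by
  obtain ⟨γ, h0, hγ⟩ := h x
  obtain ⟨α, hα0, hα⟩ := h (γ (T / 2))
  obtain ⟨β, hβ0, hβ⟩ := h (γ (-(T / 2)))
  have hα' : ∀ t ∈ Ioo (-(T / 2)) (3 / 2 * T),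
      HasDerivAt (fun s => α (s + -(T / 2))) (v (α (t + -(T / 2)))) t := fun t ht =>
    (hα _ ⟨by linarith [ht.1], by linarith [ht.2]⟩).comp_add_const t _
  have hβ' : ∀ t ∈ Ioo (-(3 / 2 * T)) (T / 2),
      HasDerivAt (fun s => β (s + T / 2)) (v (β (t + T / 2))) t := fun t ht =>
    (hβ _ ⟨by linarith [ht.1], by linarith [ht.2]⟩).comp_add_const t _
  have eα : EqOn γ (fun s => α (s + -(T / 2))) (Ioo (-(T / 2)) T) :=
    hv.eqOn_Ioo_of_hasDerivAt (t₀ := T / 2) ⟨by linarith, by linarith⟩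
      (fun t ht => hγ t ⟨by linarith [ht.1], ht.2⟩)
      (fun t ht => hα' t ⟨ht.1, by linarith [ht.2]⟩) (by simp [hα0])
  have eβ : EqOn γ (fun s => β (s + T / 2)) (Ioo (-T) (T / 2)) :=
    hv.eqOn_Ioo_of_hasDerivAt (t₀ := -(T / 2)) ⟨by linarith, by linarith⟩
      (fun t ht => hγ t ⟨ht.1, by linarith [ht.2]⟩)
      (fun t ht => hβ' t ⟨by linarith [ht.1], ht.2⟩) (by simp [hβ0])
  set δ : ℝ → E := fun t => if t ≤ 0 then β (t + T / 2) else α (t + -(T / 2)) with hδ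
  have dγ : ∀ t ∈ Ioo (-(T / 2)) (T / 2), δ t = γ t := fun t ht => by
    by_cases h' : t ≤ 0
    · simp only [hδ, h', if_true]
      exact (eβ ⟨by linarith [ht.1], ht.2⟩).symm
    · simp only [hδ, h', if_false]
      exact (eα ⟨ht.1, by linarith [ht.2]⟩).symm
  refine ⟨δ, by rw [dγ 0 ⟨by linarith, by linarith⟩, h0], fun t ht => ?_⟩
  rcases lt_trichotomy t 0 with h' | h' | h'
  · have : δ =ᶠ[𝓝 t] fun s => β (s + T / 2) := by
      filter_upwards [Iio_mem_nhds h'] with s hs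
      simp [hδ, (show s ≤ 0 from le_of_lt hs)]
    rw [this.hasDerivAt_iff, this.eq_of_nhds]
    exact hβ' t ⟨ht.1, by linarith⟩
  · have : δ =ᶠ[𝓝 t] γ := by
      filter_upwards [Ioo_mem_nhds (show -(T / 2) < t by linarith) (show t < T / 2 by linarith)]
        with s hs using dγ s hs
    rw [this.hasDerivAt_iff, this.eq_of_nhds]
    exact hγ t ⟨by linarith, by linarith⟩
  · have : δ =ᶠ[𝓝 t] fun s => α (s + -(T / 2)) := by
      filter_upwards [Ioi_mem_nhds h'] with s hs
      simp [hδ, (show ¬ s ≤ 0 from not_le.2 hs)]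
    rw [this.hasDerivAt_iff, this.eq_of_nhds]
    exact hα' t ⟨by linarith, ht.2⟩

/-- A globally Lipschitz autonomous equation has global solutions. -/
theorem LipschitzWith.exists_global_solution [CompleteSpace E] {v : E → E} {K : ℝ≥0}
    (hv : LipschitzWith K v) (x : E) :
    ∃ γ : ℝ → E, γ 0 = x ∧ ∀ t, HasDerivAt γ (v (γ t)) t := by
  set ε : ℝ := 1 / (1 + K) with hε
  have hε0 : 0 < ε := by positivity
  have key : ∀ n : ℕ, ∀ x, ∃ γ : ℝ → E, γ 0 = x ∧
      ∀ t ∈ Ioo (-((3 / 2) ^ n * ε)) ((3 / 2) ^ n * ε), HasDerivAt γ (v (γ t)) t := by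
    intro n
    induction n with
    | zero => simpa only [pow_zero, one_mul] using hv.exists_local_solution
    | succ n ih =>
      intro x
      have := hv.exists_solution_extend (by positivity) ih x
      simpa only [pow_succ', mul_assoc] using this
  have hbig : ∀ T : ℝ, ∃ γ : ℝ → E, γ 0 = x ∧ ∀ t ∈ Ioo (-T) T, HasDerivAt γ (v (γ t)) t := by
    intro T
    obtain ⟨n, hn⟩ := pow_unbounded_of_one_lt (T / ε) (show (1 : ℝ) < 3 / 2 by norm_num)
    rw [div_lt_iff₀ hε0] at hn
    obtain ⟨γ, h0, hγ⟩ := key n x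
    exact ⟨γ, h0, fun t ht => hγ t ⟨by linarith [ht.1], by linarith [ht.2]⟩⟩
  choose α h0 hα using hbig
  have agree : ∀ S T : ℝ, ∀ t ∈ Ioo (-S) S, t ∈ Ioo (-T) T → α S t = α T t := by
    intro S T t hS hT
    have hm : t ∈ Ioo (-(min S T)) (min S T) := by
      rw [mem_Ioo, ← abs_lt] at *; exact lt_min hS hT
    have hpos : 0 < min S T := by linarith [hm.1, hm.2]
    exact hv.eqOn_Ioo_of_hasDerivAt (t₀ := 0) ⟨by linarith, hpos⟩
      (fun s hs => hα S s ⟨by linarith [hs.1, min_le_left S T], hs.2.trans_le (min_le_left _ _)⟩)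
      (fun s hs => hα T s ⟨by linarith [hs.1, min_le_right S T], hs.2.trans_le (min_le_right _ _)⟩)
      (by rw [h0, h0]) hm
  refine ⟨fun t => α (|t| + 1) t, h0 _, fun t => ?_⟩
  have hself : ∀ s : ℝ, s ∈ Ioo (-(|s| + 1)) (|s| + 1) := fun s => by
    rw [mem_Ioo, ← abs_lt]; linarith
  have : (fun s => α (|s| + 1) s) =ᶠ[𝓝 t] α (|t| + 1) := by
    filter_upwards [Ioo_mem_nhds (hself t).1 (hself t).2] with s hs
      using agree _ _ s (hself s) hs
  rw [this.hasDerivAt_iff]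
  exact hα _ t (hself t)

/-- Solutions of a Lipschitz autonomous equation depend continuously on the initial value. -/
theorem LipschitzWith.dist_solution_le {v : E → E} {K : ℝ≥0} (hv : LipschitzWith K v)
    {f g : ℝ → E} (hf : ∀ t, HasDerivAt f (v (f t)) t) (hg : ∀ t, HasDerivAt g (v (g t)) t)
    (t : ℝ) : dist (f t) (g t) ≤ dist (f 0) (g 0) * Real.exp (K * |t|) := by
  have forward : ∀ {w : E → E} {f g : ℝ → E}, LipschitzWith K w →
      (∀ t, HasDerivAt f (w (f t)) t) → (∀ t, HasDerivAt g (w (g t)) t) → ∀ t, 0 ≤ t →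
      dist (f t) (g t) ≤ dist (f 0) (g 0) * Real.exp (K * t) := by
    intro w f g hw hf hg t ht
    have := dist_le_of_trajectories_ODE (v := fun _ => w) (a := 0) (b := t) (fun _ => hw)
      (fun s _ => (hf s).continuousAt.continuousWithinAt) (fun s _ => (hf s).hasDerivWithinAt)
      (fun s _ => (hg s).continuousAt.continuousWithinAt) (fun s _ => (hg s).hasDerivWithinAt)
      le_rfl t ⟨ht, le_rfl⟩
    simpa using this
  rcases le_total 0 t with ht | ht
  · rw [abs_of_nonneg ht]
    exact forward hv hf hg t ht
  · have hneg : ∀ {f : ℝ → E}, (∀ t, HasDerivAt f (v (f t)) t) →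
        ∀ t, HasDerivAt (fun s => f (-s)) ((-v) (f (-t))) t := fun hf t => by
      simpa [Function.comp_def] using (hf (-t)).scomp t (hasDerivAt_neg t)
    have := forward (w := -v) hv.neg (hneg hf) (hneg hg) (-t) (by linarith)
    simpa [abs_of_nonpos ht] using this

/-- `φ` is the flow of the vector field `v`, with Lipschitz constant `K`. -/
structure IsLipschitzFlow (v : E → E) (K : ℝ≥0) (φ : ℝ → E → E) : Prop where
  zero : ∀ x, φ 0 x = x
  hasDerivAt : ∀ x t, HasDerivAt (fun s => φ s x) (v (φ t x)) t
  add : ∀ s t x, φ (s + t) x = φ s (φ t x)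
  dist_le : ∀ t x y, dist (φ t x) (φ t y) ≤ dist x y * Real.exp (K * |t|)
  equilibrium : ∀ x, v x = 0 → ∀ t, φ t x = x

theorem IsLipschitzFlow.continuous {v : E → E} {K : ℝ≥0} {φ : ℝ → E → E}
    (h : IsLipschitzFlow v K φ) (t : ℝ) : Continuous (φ t) :=
  (LipschitzWith.of_dist_le_mul (K := (Real.exp (K * |t|)).toNNReal) fun x y => by
    rw [Real.coe_toNNReal _ (Real.exp_pos _).le, mul_comm]
    exact h.dist_le t x y).continuous

theorem IsLipschitzFlow.continuous_orbit {v : E → E} {K : ℝ≥0} {φ : ℝ → E → E}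
    (h : IsLipschitzFlow v K φ) (x : E) : Continuous fun t => φ t x :=
  continuous_iff_continuousAt.2 fun t => (h.hasDerivAt x t).continuousAt

/-- A globally Lipschitz autonomous equation generates a flow. -/
theorem LipschitzWith.exists_flow [CompleteSpace E] {v : E → E} {K : ℝ≥0}
    (hv : LipschitzWith K v) : ∃ φ : ℝ → E → E, IsLipschitzFlow v K φ := by
  choose γ h0 hγ using hv.exists_global_solution
  have uniq : ∀ {f g : ℝ → E}, (∀ t, HasDerivAt f (v (f t)) t) →
      (∀ t, HasDerivAt g (v (g t)) t) → f 0 = g 0 → ∀ t, f t = g t := by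
    intro f g hf hg h t
    have := hv.dist_solution_le hf hg t
    rw [h, dist_self, zero_mul] at this
    exact dist_le_zero.1 this
  refine ⟨fun t x => γ x t, h0, fun x t => hγ x t, fun s t x => ?_, fun t x y => ?_,
    fun x hx t => ?_⟩
  · exact uniq (f := fun r => γ x (r + t)) (fun r => (hγ x (r + t)).comp_add_const r t)
      (hγ _) (by simp [h0]) s
  · simpa [h0] using hv.dist_solution_le (hγ x) (hγ y) t
  · refine uniq (g := fun _ => x) (hγ x) (fun r => ?_) (h0 x) t
    rw [hx]; exact hasDerivAt_const r x

end LipschitzFlow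

/-! ### Energy, LaSalle's principle and the saddle-to-well connection -/

section Connection

open Set

/-- LaSalle's invariance principle for a precompact orbit: if the energy converges along the orbit
and `q` is the only point of the compact set with constant energy along its own orbit, then the
orbit converges to `q`. -/
theorem tendsto_of_unique_constant_energy {X : Type*} [TopologicalSpace X]
    {φ : ℝ → X → X} (hadd : ∀ s t x, φ (s + t) x = φ s (φ t x)) (hcont : ∀ t, Continuous (φ t))
    {W : X → ℝ} (hW : Continuous W) {l : Filter ℝ} (hl : ∀ s : ℝ, Tendsto (fun t => s + t) l l)
    {w q : X} {e : ℝ} (he : Tendsto (fun t => W (φ t w)) l (𝓝 e)) {C : Set X} (hC : IsCompact C)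
    (hmem : ∀ᶠ t in l, φ t w ∈ C) (hq : ∀ p ∈ C, (∀ s, W (φ s p) = W (φ 0 p)) → p = q) :
    Tendsto (fun t => φ t w) l (𝓝 q) := by
  refine hC.tendsto_nhds_of_unique_mapClusterPt hmem fun p hp hclu => hq p hp ?_
  -- φ s carries the cluster point p to a cluster point of the shifted orbit, along which W still
  -- tends to e.
  have key : ∀ s, W (φ s p) = e := by
    intro s
    have h1 : MapClusterPt (W (φ s p)) l ((fun x => W (φ s x)) ∘ fun t => φ t w) :=
      hclu.continuousAt_comp (f := fun x => W (φ s x)) (hW.comp (hcont s)).continuousAt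
    have h2 : Tendsto ((fun x => W (φ s x)) ∘ fun t => φ t w) l (𝓝 e) := by
      refine (he.comp (hl s)).congr fun t => ?_
      simp [hadd]
    have h3 : ClusterPt (W (φ s p)) (𝓝 e) := h1.clusterPt.mono h2
    exact eq_of_nhds_neBot h3
  intro s
  rw [key, key]

/-- The vector field of `P' = Q`, `Q' = F P - ν Q`. -/
def dampedField (F : ℝ → ℝ) (ν : ℝ) (z : ℝ × ℝ) : ℝ × ℝ := (z.2, F z.1 - ν * z.2)

theorem LipschitzWith.dampedField {F : ℝ → ℝ} {K : NNReal} (hF : LipschitzWith K F) (ν : ℝ) :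
    ∃ L, LipschitzWith L (dampedField F ν) := by
  have h1 : LipschitzWith 1 (Prod.snd : ℝ × ℝ → ℝ) := LipschitzWith.prod_snd
  have h2 : LipschitzWith (K * 1) (fun z : ℝ × ℝ => F z.1) := hF.comp LipschitzWith.prod_fst
  have h3 : LipschitzWith (‖ν‖₊ * 1) (fun z : ℝ × ℝ => ν • z.2) :=
    (lipschitzWith_smul ν).comp LipschitzWith.prod_snd
  exact ⟨_, h1.prodMk (h2.sub h3)⟩

/-- The potential energy `∫ x in x..b, F x` of the force `F`. -/
noncomputable def potential (F : ℝ → ℝ) (b x : ℝ) : ℝ := ∫ t in x..b, F t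

/-- The total energy of the system `P' = Q`, `Q' = F P - ν Q`. -/
noncomputable def energy (F : ℝ → ℝ) (b : ℝ) (z : ℝ × ℝ) : ℝ := z.2 ^ 2 / 2 + potential F b z.1

theorem hasDerivAt_potential {F : ℝ → ℝ} (hF : Continuous F) (b x : ℝ) :
    HasDerivAt (potential F b) (-F x) x :=
  intervalIntegral.integral_hasDerivAt_left (hF.intervalIntegrable _ _)
    (hF.stronglyMeasurableAtFilter _ _) hF.continuousAt

theorem continuous_potential {F : ℝ → ℝ} (hF : Continuous F) (b : ℝ) :
    Continuous (potential F b) :=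
  continuous_iff_continuousAt.2 fun x => (hasDerivAt_potential hF b x).continuousAt

theorem continuous_energy {F : ℝ → ℝ} (hF : Continuous F) (b : ℝ) : Continuous (energy F b) := by
  have := (continuous_potential hF b).comp (continuous_fst (X := ℝ) (Y := ℝ))
  unfold energy
  fun_prop

theorem HasDerivAt.energy_dampedField {F : ℝ → ℝ} (hF : Continuous F) (b : ℝ) {ν t : ℝ}
    {z : ℝ → ℝ × ℝ} (hz : HasDerivAt z (dampedField F ν (z t)) t) :
    HasDerivAt (fun s => energy F b (z s)) (-(ν * (z t).2 ^ 2)) t := by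
  have h1 : HasDerivAt (fun s => (z s).1) (z t).2 t := hz.fst
  have h2 : HasDerivAt (fun s => (z s).2) (F (z t).1 - ν * (z t).2) t := hz.snd
  have h3 := (hasDerivAt_potential hF b (z t).1).comp t h1
  have := ((h2.pow 2).div_const 2).add h3
  refine this.congr_deriv ?_
  push_cast
  ring

theorem antitone_energy {F : ℝ → ℝ} (hF : Continuous F) (b : ℝ) {ν : ℝ} (hν : 0 ≤ ν)
    {z : ℝ → ℝ × ℝ} (hz : ∀ t, HasDerivAt z (dampedField F ν (z t)) t) :
    Antitone fun s => energy F b (z s) :=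
  antitone_of_hasDerivAt_nonpos (fun t => (hz t).energy_dampedField hF b)
    fun t => by have := mul_nonneg hν (sq_nonneg (z t).2); simpa using this

/-- An orbit of constant energy is an equilibrium. -/
theorem equilibrium_of_energy_eventually_const {F : ℝ → ℝ} (hF : Continuous F) (b : ℝ) {ν t c : ℝ}
    (hν : 0 < ν) {z : ℝ → ℝ × ℝ} (hz : ∀ t, HasDerivAt z (dampedField F ν (z t)) t)
    (hc : ∀ᶠ s in 𝓝 t, energy F b (z s) = c) : (z t).2 = 0 ∧ F (z t).1 = 0 := by
  have hQ : ∀ᶠ s in 𝓝 t, (z s).2 = 0 := by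
    filter_upwards [hc.eventually_nhds] with s hs
    have h1 := (hz s).energy_dampedField hF b
    have h2 : HasDerivAt (fun s => energy F b (z s)) 0 s :=
      (hasDerivAt_const s c).congr_of_eventuallyEq hs
    have := h1.unique h2
    simpa [hν.ne'] using this
  have h1 : HasDerivAt (fun s => (z s).2) (F (z t).1 - ν * (z t).2) t := (hz t).snd
  have h2 : HasDerivAt (fun s => (z s).2) 0 t := (hasDerivAt_const t (0 : ℝ)).congr_of_eventuallyEq hQ
  have h3 := h1.unique h2
  have h4 := hQ.self_of_nhds
  rw [h4] at h3
  exact ⟨h4, by linarith⟩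

/-- The kinetic part is at most minus the minimum of the potential on the interval. This supplies
the compact sets for LaSalle's principle. -/
theorem exists_bound_of_energy_nonpos {F : ℝ → ℝ} (hF : Continuous F) (b c : ℝ) :
    ∃ M, ∀ z : ℝ × ℝ, z.1 ∈ Icc c b → energy F b z ≤ 0 → |z.2| ≤ M := by
  obtain ⟨m, hm⟩ := (isCompact_Icc (a := c) (b := b)).bddBelow_image
    (continuous_potential hF b).continuousOn
  refine ⟨√(2 * -m), fun z hz hE => Real.abs_le_sqrt ?_⟩
  have : m ≤ potential F b z.1 := hm (mem_image_of_mem _ hz)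
  unfold energy at hE
  linarith

theorem energy_endpoint (F : ℝ → ℝ) (b q : ℝ) : energy F b (b, q) = q ^ 2 / 2 := by
  simp [energy, potential]

variable {F : ℝ → ℝ} {ν a b c p : ℝ} {K : NNReal} {φ : ℝ → ℝ × ℝ → ℝ × ℝ}

/-- While an orbit starting with `Q ≤ 0` stays to the right of `a`, it moves to the left. -/
theorem snd_nonpos_of_le_fst {z : ℝ → ℝ × ℝ}
    (hz : ∀ t, HasDerivAt z (dampedField F ν (z t)) t) (hle : ∀ x, a ≤ x → F x ≤ 0) {T : ℝ}
    (h0 : (z 0).2 ≤ 0) (hT : ∀ t ∈ Icc 0 T, a ≤ (z t).1) : ∀ t ∈ Icc 0 T, (z t).2 ≤ 0 := by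
  -- The integrating factor e^{νt} removes the friction, leaving a derivative with the sign of F.
  have hd : ∀ t, HasDerivAt (fun s => (z s).2 * Real.exp (ν * s))
      (F (z t).1 * Real.exp (ν * t)) t := by
    intro t
    have h1 : HasDerivAt (fun s => (z s).2) (F (z t).1 - ν * (z t).2) t := (hz t).snd
    have h2 : HasDerivAt (fun s => Real.exp (ν * s)) (Real.exp (ν * t) * (ν * 1)) t :=
      ((hasDerivAt_id t).const_mul ν).exp
    refine (h1.mul h2).congr_deriv ?_
    ring
  have hanti : AntitoneOn (fun s => (z s).2 * Real.exp (ν * s)) (Icc 0 T) := by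
    refine antitoneOn_of_hasDerivWithinAt_nonpos (convex_Icc _ _)
      (fun t _ => (hd t).continuousAt.continuousWithinAt)
      (fun t _ => (hd t).hasDerivWithinAt) fun t ht => ?_
    exact mul_nonpos_of_nonpos_of_nonneg (hle _ (hT t (interior_subset ht))) (Real.exp_pos _).le
  intro t ht
  have h1 := hanti ⟨le_rfl, ht.1.trans ht.2⟩ ht ht.1
  have h2 := Real.exp_pos (ν * t)
  simp only [mul_zero, Real.exp_zero, mul_one] at h1
  by_contra hcon
  have := mul_pos (not_le.1 hcon) h2
  linarith

theorem antitoneOn_fst_of_snd_nonpos {z : ℝ → ℝ × ℝ}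
    (hz : ∀ t, HasDerivAt z (dampedField F ν (z t)) t) {T : ℝ}
    (hT : ∀ t ∈ Icc 0 T, (z t).2 ≤ 0) : AntitoneOn (fun t => (z t).1) (Icc 0 T) := by
  have hd : ∀ t, HasDerivAt (fun s => (z s).1) (z t).2 t := fun t => (hz t).fst
  exact antitoneOn_of_hasDerivWithinAt_nonpos (convex_Icc _ _)
    (fun t _ => (hd t).continuousAt.continuousWithinAt)
    (fun t _ => (hd t).hasDerivWithinAt) fun t ht => hT t (interior_subset ht)

/-- An orbit issuing from a rest point `(x, 0)` with `p < x < b` reaches the line `P = p`. -/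
theorem exists_fst_le (hφ : IsLipschitzFlow (dampedField F ν) K φ) (hF : Continuous F)
    (hν : 0 < ν) (hneg : ∀ x ∈ Ioo a b, F x < 0) (hle : ∀ x, a ≤ x → F x ≤ 0)
    (hp : p ∈ Ioo a b) {x : ℝ} (hx : x ∈ Ioo p b) (hE : energy F b (x, 0) ≤ 0) :
    ∃ t, 0 ≤ t ∧ (φ t (x, 0)).1 ≤ p := by
  by_contra! hcon
  have hz := hφ.hasDerivAt (x, 0)
  have hQ : ∀ t, 0 ≤ t → (φ t (x, 0)).2 ≤ 0 := fun t ht =>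
    snd_nonpos_of_le_fst hz hle (T := t) (by simp [hφ.zero])
      (fun s hs => hp.1.le.trans (hcon s hs.1).le) t ⟨ht, le_rfl⟩
  have hP : ∀ t, 0 ≤ t → (φ t (x, 0)).1 ≤ x := fun t ht => by
    have := antitoneOn_fst_of_snd_nonpos hz (T := t) (fun s hs => hQ s hs.1)
      ⟨le_rfl, ht⟩ ⟨ht, le_rfl⟩ ht
    simpa [hφ.zero] using this
  have hanti := antitone_energy hF b hν.le hz
  have hE' : ∀ t, 0 ≤ t → energy F b (φ t (x, 0)) ≤ 0 := fun t ht => by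
    have := hanti ht
    simp only [hφ.zero] at this
    linarith
  obtain ⟨M, hM⟩ := exists_bound_of_energy_nonpos hF b p
  have hmem : ∀ᶠ t in atTop, φ t (x, 0) ∈ Icc p x ×ˢ Icc (-M) M := by
    filter_upwards [eventually_ge_atTop 0] with t ht
    have h1 : (φ t (x, 0)).1 ∈ Icc p x := ⟨(hcon t ht).le, hP t ht⟩
    exact ⟨h1, abs_le.1 (hM _ ⟨h1.1, h1.2.trans hx.2.le⟩ (hE' t ht))⟩
  have hC : IsCompact (Icc p x ×ˢ Icc (-M) M) := isCompact_Icc.prod isCompact_Icc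
  obtain ⟨e, he⟩ : ∃ e, Tendsto (fun t => energy F b (φ t (x, 0))) atTop (𝓝 e) := by
    rcases tendsto_atTop_of_antitone hanti with h | h
    · exfalso
      obtain ⟨m, hm⟩ := hC.bddBelow_image (continuous_energy hF b).continuousOn
      obtain ⟨t, h1, h2⟩ := (hmem.and (h.eventually_lt_atBot m)).exists
      exact absurd (hm (mem_image_of_mem _ h1)) (not_le.2 h2)
    · exact h
  have hno : ∀ r ∈ Icc p x ×ˢ Icc (-M) M,
      ¬ ∀ s, energy F b (φ s r) = energy F b (φ 0 r) := fun r hr hs => by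
    have := (equilibrium_of_energy_eventually_const hF b hν (hφ.hasDerivAt r) (t := 0)
      (Eventually.of_forall hs)).2
    rw [hφ.zero] at this
    exact (hneg r.1 ⟨hp.1.trans_le hr.1.1, hr.1.2.trans_lt hx.2⟩).ne this
  -- The compact strip contains no equilibrium, so the uniqueness condition holds vacuously for
  -- every q and the orbit would have two limits.
  have key : ∀ q, Tendsto (fun t => φ t (x, 0)) atTop (𝓝 q) := fun q =>
    tendsto_of_unique_constant_energy hφ.add hφ.continuous (continuous_energy hF b)
      (fun s => tendsto_atTop_add_const_left _ s tendsto_id) he hC hmem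
      fun r hr hs => absurd hs (hno r hr)
  have := tendsto_nhds_unique (key (0, 0)) (key (1, 0))
  simp at this

theorem potential_nonpos (hF : Continuous F) (hle : ∀ x, a ≤ x → F x ≤ 0) {x : ℝ}
    (hx : x ∈ Icc a b) : potential F b x ≤ 0 := by
  have := intervalIntegral.integral_mono_on (μ := MeasureTheory.volume) hx.2
    (hF.intervalIntegrable x b)
    (intervalIntegrable_const (c := (0 : ℝ)))
    fun y hy => hle y (hx.1.trans hy.1)
  simpa [potential] using this

/-- Orbit segments of arbitrary length, ending on the line `P = p`, along which `P ∈ [p, b]`. -/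
theorem exists_orbit_segment (hφ : IsLipschitzFlow (dampedField F ν) K φ) (hF : Continuous F)
    (hν : 0 < ν) (hb : F b = 0) (hneg : ∀ x ∈ Ioo a b, F x < 0) (hle : ∀ x, a ≤ x → F x ≤ 0)
    (hp : p ∈ Ioo a b) {T : ℝ} (hT : 0 ≤ T) :
    ∃ w : ℝ × ℝ, w.1 = p ∧ ∀ t ∈ Icc (-T) 0,
      (φ t w).1 ∈ Icc p b ∧ (φ t w).2 ≤ 0 ∧ energy F b (φ t w) ≤ 0 := by
  have heq : dampedField F ν (b, 0) = 0 := by simp [dampedField, hb]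
  have hexp : 1 ≤ Real.exp (K * T) := Real.one_le_exp (by positivity)
  -- Orbits separate at most by the factor e^{KT} up to time T, so a start at distance ε from the
  -- saddle stays within (b - p)/2 of it and cannot reach P = p before T.
  set ε := (b - p) / (2 * Real.exp (K * T)) with hε
  have hbp : 0 < b - p := sub_pos.2 hp.2
  have hε0 : 0 < ε := by positivity
  have hεT : ε * Real.exp (K * T) = (b - p) / 2 := by rw [hε]; field_simp
  have hεb : ε ≤ (b - p) / 2 := by nlinarith
  set x := b - ε with hx
  have hxm : x ∈ Ioo p b := ⟨by linarith, by linarith⟩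
  have hE : energy F b (x, 0) ≤ 0 := by
    have := potential_nonpos hF hle (x := x) ⟨by linarith [hp.1, hxm.1], hxm.2.le⟩
    simpa [energy] using this
  have hz := hφ.hasDerivAt (x, 0)
  have hcP : Continuous fun t => (φ t (x, 0)).1 :=
    continuous_fst.comp (hφ.continuous_orbit _)
  set S := {t : ℝ | 0 ≤ t ∧ (φ t (x, 0)).1 ≤ p} with hS
  have hSne : S.Nonempty := exists_fst_le hφ hF hν hneg hle hp hxm hE
  have hSbdd : BddBelow S := ⟨0, fun t ht => ht.1⟩
  have hScl : IsClosed S := isClosed_Ici.inter (isClosed_le hcP continuous_const)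
  set τ := sInf S with hτ
  have hτS : τ ∈ S := hScl.csInf_mem hSne hSbdd
  have hbefore : ∀ t, 0 ≤ t → t < τ → p < (φ t (x, 0)).1 := fun t h0 h1 => by
    by_contra hcon
    exact absurd (csInf_le hSbdd (show t ∈ S from ⟨h0, not_lt.1 hcon⟩)) (not_le.2 h1)
  have hτp : (φ τ (x, 0)).1 = p := by
    refine le_antisymm hτS.2 ?_
    have hτ0 : 0 < τ := by
      refine lt_of_le_of_ne hτS.1 fun h => ?_
      have := hτS.2
      rw [← h, hφ.zero] at this
      exact absurd this (not_le.2 hxm.1)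
    refine ge_of_tendsto (hcP.continuousWithinAt (s := Iio τ) (x := τ)).tendsto ?_
    filter_upwards [Ioo_mem_nhdsLT hτ0] with t ht using (hbefore t ht.1.le ht.2).le
  have hPge : ∀ t ∈ Icc 0 τ, p ≤ (φ t (x, 0)).1 := fun t ht => by
    rcases ht.2.eq_or_lt with h | h
    · rw [h, hτp]
    · exact (hbefore t ht.1 h).le
  have hQ := snd_nonpos_of_le_fst hz hle (T := τ) (by simp [hφ.zero])
    fun t ht => hp.1.le.trans (hPge t ht)
  have hP := antitoneOn_fst_of_snd_nonpos hz hQ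
  have hTτ : T ≤ τ := by
    by_contra hcon
    have h1 := hφ.dist_le τ (x, 0) (b, 0)
    rw [hφ.equilibrium _ heq] at h1
    have h2 : |(φ τ (x, 0)).1 - b| ≤ dist (φ τ (x, 0)) (b, 0) := le_max_left _ _
    have h3 : dist ((x, 0) : ℝ × ℝ) (b, 0) = ε := by
      simp [Prod.dist_eq, hx, abs_of_pos hε0, hε0.le]
    rw [hτp, abs_sub_comm, abs_of_pos hbp] at h2
    rw [h3] at h1
    have h4 : Real.exp (K * |τ|) ≤ Real.exp (K * T) := by
      rw [abs_of_nonneg hτS.1]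
      gcongr
      exact (not_le.1 hcon).le
    have h5 : ε * Real.exp (K * |τ|) ≤ ε * Real.exp (K * T) := by gcongr
    linarith
  refine ⟨φ τ (x, 0), hτp, fun t ht => ?_⟩
  have ht' : t + τ ∈ Icc 0 τ := ⟨by linarith [ht.1], by linarith [ht.2]⟩
  rw [← hφ.add]
  have h1 := hP ⟨le_rfl, hτS.1⟩ ht' ht'.1
  have h2 := antitone_energy hF b hν.le hz ht'.1
  simp only [hφ.zero] at h1 h2
  exact ⟨⟨hPge _ ht', by linarith [hxm.2]⟩, hQ _ ht', by linarith⟩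

/-- There is an orbit of negative energy which tends to the saddle `(b, 0)` as `t → -∞`. -/
theorem exists_unstable_orbit (hφ : IsLipschitzFlow (dampedField F ν) K φ) (hF : Continuous F)
    (hν : 0 < ν) (hb : F b = 0) (hneg : ∀ x ∈ Ioo a b, F x < 0) (hle : ∀ x, a ≤ x → F x ≤ 0)
    (hp : p ∈ Ioo a b) :
    ∃ w : ℝ × ℝ, w.1 = p ∧ energy F b w < 0 ∧ (∀ t ≤ 0, (φ t w).1 ∈ Icc p b) ∧
      Tendsto (fun t => φ t w) atBot (𝓝 (b, 0)) := by
  obtain ⟨M, hM⟩ := exists_bound_of_energy_nonpos hF b p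
  set R := Icc p b ×ˢ Icc (-M) 0 with hR
  have hRc : IsCompact R := isCompact_Icc.prod isCompact_Icc
  -- Points of the line P = p whose backward orbit stays in R for time n. These nested nonempty
  -- compact sets share a point, whose entire backward orbit stays in R.
  set N : ℕ → Set (ℝ × ℝ) := fun n => {w | w.1 = p} ∩ ⋂ t ∈ Icc (-(n : ℝ)) 0, φ t ⁻¹' R with hN
  have hNcl : ∀ n, IsClosed (N n) := fun n =>
    (isClosed_eq continuous_fst continuous_const).inter <| isClosed_biInter fun t _ =>
      hRc.isClosed.preimage (hφ.continuous t)
  have hNsub : ∀ n, N n ⊆ R := fun n w hw => by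
    have := mem_iInter₂.1 hw.2 0 ⟨by simp, le_rfl⟩
    rwa [mem_preimage, hφ.zero] at this
  have hNne : ∀ n, (N n).Nonempty := fun n => by
    obtain ⟨w, hw, h⟩ := exists_orbit_segment hφ hF hν hb hneg hle hp n.cast_nonneg
    refine ⟨w, hw, mem_iInter₂.2 fun t ht => ?_⟩
    obtain ⟨h1, h2, h3⟩ := h t ht
    exact ⟨h1, (abs_le.1 (hM _ h1 h3)).1, h2⟩
  have hNmono : ∀ n, N (n + 1) ⊆ N n := fun n w hw =>
    ⟨hw.1, mem_iInter₂.2 fun t ht => mem_iInter₂.1 hw.2 t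
      ⟨by push_cast; linarith [ht.1], ht.2⟩⟩
  obtain ⟨w, hw⟩ := IsCompact.nonempty_iInter_of_sequence_nonempty_isCompact_isClosed N hNmono hNne
    (hRc.of_isClosed_subset (hNcl 0) (hNsub 0)) hNcl
  rw [mem_iInter] at hw
  have hback : ∀ t ≤ 0, φ t w ∈ R := fun t ht => by
    obtain ⟨n, hn⟩ := exists_nat_ge (-t)
    exact mem_iInter₂.1 (hw n).2 t ⟨by linarith, ht⟩
  have hwp : w.1 = p := (hw 0).1
  have hanti := antitone_energy hF b hν.le (hφ.hasDerivAt w)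
  have hmem : ∀ᶠ t in atBot, φ t w ∈ R := (eventually_le_atBot 0).mono hback
  obtain ⟨e, he⟩ : ∃ e, Tendsto (fun t => energy F b (φ t w)) atBot (𝓝 e) := by
    rcases tendsto_atBot_of_antitone hanti with h | h
    · exfalso
      obtain ⟨m, hm⟩ := hRc.bddAbove_image (continuous_energy hF b).continuousOn
      obtain ⟨t, h1, h2⟩ := (hmem.and (h.eventually_gt_atTop m)).exists
      exact absurd (hm (mem_image_of_mem _ h1)) (not_le.2 h2)
    · exact h
  have heq : ∀ r ∈ R, r.2 = 0 ∧ F r.1 = 0 → r = (b, 0) := fun r hr h => by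
    have : r.1 = b := by
      by_contra hne
      exact (hneg r.1 ⟨hp.1.trans_le hr.1.1, lt_of_le_of_ne hr.1.2 hne⟩).ne h.2
    exact Prod.ext this h.1
  have hlim : Tendsto (fun t => φ t w) atBot (𝓝 (b, 0)) := by
    refine tendsto_of_unique_constant_energy hφ.add hφ.continuous (continuous_energy hF b)
      (fun s => tendsto_atBot_add_const_left _ s tendsto_id) he hRc hmem fun r hr hs => ?_
    have := equilibrium_of_energy_eventually_const hF b hν (hφ.hasDerivAt r) (t := 0)
      (Eventually.of_forall hs)
    rw [hφ.zero] at this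
    exact heq r hr this
  have hE0 : Tendsto (fun t => energy F b (φ t w)) atBot (𝓝 0) := by
    have := ((continuous_energy hF b).tendsto (b, 0)).comp hlim
    simpa [energy_endpoint, Function.comp_def] using this
  have hEle : ∀ t, energy F b (φ t w) ≤ 0 := fun t =>
    ge_of_tendsto hE0 ((eventually_le_atBot t).mono fun s hs => hanti hs)
  have hEw : energy F b w ≤ 0 := by simpa [hφ.zero] using hEle 0
  refine ⟨w, hwp, lt_of_le_of_ne hEw fun h0 => ?_, fun t ht => (hback t ht).1, hlim⟩
  -- Zero energy at w would make the energy vanish for all t ≤ 0; the orbit would rest at (b, 0) at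
  -- time -1, hence also at time 0, contradicting p < b.
  have hconst : ∀ᶠ t in 𝓝 (-1 : ℝ), energy F b (φ t w) = 0 := by
    filter_upwards [Iio_mem_nhds (show (-1 : ℝ) < 0 by norm_num)] with t ht
    refine le_antisymm (hEle t) ?_
    have := hanti (le_of_lt ht)
    simpa [hφ.zero, h0] using this
  have h1 := heq _ (hback (-1) (by norm_num))
    (equilibrium_of_energy_eventually_const hF b hν (hφ.hasDerivAt w) hconst)
  have h2 := hφ.add 1 (-1) w
  rw [h1, hφ.equilibrium (b, 0) (by simp [dampedField, hb]), add_neg_cancel, hφ.zero] at h2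
  rw [h2] at hwp
  exact hp.2.ne' hwp

/-- A damped system with a potential well at `a`, bounded by a saddle at `b > a` and by a barrier
at `c < a`, has an orbit connecting the saddle to the bottom of the well. -/
theorem exists_connection_dampedField (hF : LipschitzWith K F) (hν : 0 < ν) (hca : c < a)
    (hab : a < b) (hb : F b = 0) (hneg : ∀ x ∈ Ioo a b, F x < 0)
    (hle : ∀ x, a ≤ x → F x ≤ 0) (hpos : ∀ x ∈ Ico c a, 0 < F x) (hV : 0 ≤ potential F b c) :
    ∃ z : ℝ → ℝ × ℝ, (∀ t, HasDerivAt z (dampedField F ν (z t)) t) ∧ (∀ t, (z t).1 ∈ Icc c b) ∧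
      Tendsto z atBot (𝓝 (b, 0)) ∧ Tendsto z atTop (𝓝 (a, 0)) := by
  obtain ⟨L, hL⟩ := hF.dampedField ν
  obtain ⟨φ, hφ⟩ := hL.exists_flow
  have hFc := hF.continuous
  have hp : (a + b) / 2 ∈ Ioo a b := ⟨by linarith, by linarith⟩
  obtain ⟨w, hwp, hEw, hback, hlim⟩ := exists_unstable_orbit hφ hFc hν hb hneg hle hp
  have hanti := antitone_energy hFc b hν.le (hφ.hasDerivAt w)
  have hcP : Continuous fun t => (φ t w).1 := continuous_fst.comp (hφ.continuous_orbit _)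
  have hEneg : ∀ t, 0 ≤ t → energy F b (φ t w) ≤ energy F b w := fun t ht => by
    have := hanti ht
    simpa [hφ.zero] using this
  -- The potential is nonnegative at c and at b, so an orbit of negative energy can cross neither.
  have hne : ∀ t, 0 ≤ t → (φ t w).1 ≠ c ∧ (φ t w).1 ≠ b := fun t ht => by
    have h1 := (hEneg t ht).trans_lt hEw
    have h2 := sq_nonneg (φ t w).2
    have h3 : potential F b b = 0 := by simp [potential]
    unfold energy at h1
    constructor <;> intro h <;> rw [h] at h1 <;> linarith
  have hP0 : (φ 0 w).1 ∈ Ioo c b := by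
    rw [hφ.zero, hwp]; exact ⟨hca.trans hp.1, hp.2⟩
  have hfwd : ∀ t, 0 ≤ t → (φ t w).1 ∈ Ioo c b := fun t ht => by
    constructor
    · by_contra hcon
      obtain ⟨s, hs, h⟩ := intermediate_value_Icc' ht hcP.continuousOn
        ⟨not_lt.1 hcon, hP0.1.le⟩
      exact (hne s hs.1).1 h
    · by_contra hcon
      obtain ⟨s, hs, h⟩ := intermediate_value_Icc ht hcP.continuousOn
        ⟨hP0.2.le, not_lt.1 hcon⟩
      exact (hne s hs.1).2 h
  have hall : ∀ t, (φ t w).1 ∈ Icc c b := fun t => by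
    rcases le_total 0 t with ht | ht
    · exact Ioo_subset_Icc_self (hfwd t ht)
    · exact ⟨(hca.trans hp.1).le.trans (hback t ht).1, (hback t ht).2⟩
  refine ⟨fun t => φ t w, hφ.hasDerivAt w, hall, hlim, ?_⟩
  obtain ⟨M, hM⟩ := exists_bound_of_energy_nonpos hFc b c
  -- The energy bound excludes P = b, leaving (a, 0) as the only possible equilibrium in C.
  set C := (Icc c b ×ˢ Icc (-M) M) ∩ {z | energy F b z ≤ energy F b w} with hC
  have hCc : IsCompact C := (isCompact_Icc.prod isCompact_Icc).inter_right
    (isClosed_le (continuous_energy hFc b) continuous_const)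
  have hmem : ∀ᶠ t in atTop, φ t w ∈ C := by
    filter_upwards [eventually_ge_atTop 0] with t ht
    exact ⟨⟨hall t, abs_le.1 (hM _ (hall t) ((hEneg t ht).trans hEw.le))⟩, hEneg t ht⟩
  obtain ⟨e, he⟩ : ∃ e, Tendsto (fun t => energy F b (φ t w)) atTop (𝓝 e) := by
    rcases tendsto_atTop_of_antitone hanti with h | h
    · exfalso
      obtain ⟨m, hm⟩ := hCc.bddBelow_image (continuous_energy hFc b).continuousOn
      obtain ⟨t, h1, h2⟩ := (hmem.and (h.eventually_lt_atBot m)).exists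
      exact absurd (hm (mem_image_of_mem _ h1)) (not_le.2 h2)
    · exact h
  refine tendsto_of_unique_constant_energy hφ.add hφ.continuous (continuous_energy hFc b)
    (fun s => tendsto_atTop_add_const_left _ s tendsto_id) he hCc hmem fun r hr hs => ?_
  obtain ⟨h1, h2⟩ := equilibrium_of_energy_eventually_const hFc b hν (hφ.hasDerivAt r) (t := 0)
    (Eventually.of_forall hs)
  rw [hφ.zero] at h1 h2
  refine Prod.ext ?_ h1
  have hrb : r.1 ≠ b := fun h => by
    have h3 : energy F b r ≤ energy F b w := hr.2
    rw [show r = (b, r.2) from Prod.ext h rfl, energy_endpoint] at h3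
    linarith [sq_nonneg r.2]
  rcases lt_trichotomy r.1 a with h | h | h
  · exact absurd h2 (hpos _ ⟨hr.1.1.1, h⟩).ne'
  · exact h
  · exact absurd h2 (hneg _ ⟨h, lt_of_le_of_ne hr.1.1.2 hrb⟩).ne

end Connection

/-! ### Oscillation around an underdamped equilibrium -/

section Oscillation

open Set

/-- Sturm comparison: a nonnegative solution of `v'' ≤ -δ² v` on an interval of length `π / δ`
vanishes at the left end point. -/
theorem eq_zero_of_sturm {v v₁ v₂ : ℝ → ℝ} {δ y : ℝ} (hδ : 0 < δ)
    (hv : ∀ t, HasDerivAt v (v₁ t) t) (hv₁ : ∀ t, HasDerivAt v₁ (v₂ t) t)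
    (h0 : ∀ t, y ≤ t → 0 ≤ v t) (h2 : ∀ t, y ≤ t → v₂ t ≤ -δ ^ 2 * v t) : v y = 0 := by
  -- The Wronskian of v with sin(δ(t - y)) is nonincreasing over a half period, from -δ v(y) to δ
  -- v(y + π/δ). Both values of v being nonnegative, they vanish.
  have hd : ∀ t, HasDerivAt
      (fun t => v₁ t * Real.sin (δ * (t - y)) - δ * (v t * Real.cos (δ * (t - y))))
      ((v₂ t + δ ^ 2 * v t) * Real.sin (δ * (t - y))) t := by
    intro t
    have hl : HasDerivAt (fun t => δ * (t - y)) δ t := by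
      simpa using ((hasDerivAt_id t).sub_const y).const_mul δ
    refine (((hv₁ t).mul hl.sin).sub (((hv t).mul hl.cos).const_mul δ)).congr_deriv ?_
    ring
  have hπ : 0 < Real.pi / δ := by positivity
  have hanti := antitoneOn_of_hasDerivWithinAt_nonpos (convex_Icc y (y + Real.pi / δ))
    (fun t _ => (hd t).continuousAt.continuousWithinAt)
    (fun t _ => (hd t).hasDerivWithinAt) fun t ht => by
      rw [interior_Icc] at ht
      have h3 := h2 t ht.1.le
      refine mul_nonpos_of_nonpos_of_nonneg (by linarith) (Real.sin_nonneg_of_nonneg_of_le_pi ?_ ?_)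
      · exact mul_nonneg hδ.le (by linarith [ht.1])
      · have := mul_le_mul_of_nonneg_left (show t - y ≤ Real.pi / δ by linarith [ht.2]) hδ.le
        rwa [mul_div_cancel₀ _ hδ.ne'] at this
  have := hanti ⟨le_rfl, by linarith⟩ ⟨by linarith, le_rfl⟩ (by linarith : y ≤ y + Real.pi / δ)
  simp only [add_sub_cancel_left, mul_div_cancel₀ _ hδ.ne', Real.sin_pi, Real.cos_pi, sub_self,
    mul_zero, Real.sin_zero, Real.cos_zero] at this
  have h3 := h0 y le_rfl
  have h4 := mul_nonneg hδ.le (h0 (y + Real.pi / δ) (by linarith))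
  nlinarith

/-- An orbit converging to an underdamped equilibrium, which eventually stays on one side of it,
is eventually at rest. -/
theorem eventually_eq_of_underdamped {F : ℝ → ℝ} {F' ν a σ : ℝ} {z : ℝ → ℝ × ℝ}
    (hz : ∀ t, HasDerivAt z (dampedField F ν (z t)) t) (hF : HasDerivAt F F' a) (hFa : F a = 0)
    (hF' : F' < -(ν / 2) ^ 2) (hlim : Tendsto z atTop (𝓝 (a, 0))) (hσ : σ * σ = 1)
    (hside : ∀ᶠ t in atTop, 0 ≤ σ * ((z t).1 - a)) : ∀ᶠ t in atTop, z t = (a, 0) := by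
  -- The slack between F' and m absorbs the nonlinearity near a; the gap between m and -(ν/2)²
  -- becomes δ².
  obtain ⟨m, hm1, hm2⟩ := exists_between hF'
  set δ := √(-m - (ν / 2) ^ 2) with hδdef
  have hδ : 0 < δ := Real.sqrt_pos.2 (by linarith)
  have hδ2 : δ ^ 2 = -m - (ν / 2) ^ 2 := Real.sq_sqrt (by linarith)
  have hP : Tendsto (fun t => (z t).1) atTop (𝓝 a) := hlim.fst_nhds
  have hloc : ∀ᶠ x in 𝓝 a, F x * (x - a) ≤ m * (x - a) ^ 2 := by
    have h1 := (hasDerivAt_iff_tendsto_slope.1 hF).eventually_lt_const hm1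
    rw [eventually_nhdsWithin_iff] at h1
    filter_upwards [h1] with x hx
    by_cases hxa : x = a
    · simp [hxa]
    · have h2 := hx hxa
      have h3 : 0 < (x - a) ^ 2 := by
        have := sub_ne_zero.2 hxa
        positivity
      rw [slope_def_field, hFa, sub_zero] at h2
      have h4 : F x * (x - a) = F x / (x - a) * (x - a) ^ 2 := by
        have := sub_ne_zero.2 hxa
        field_simp
      rw [h4]
      exact mul_le_mul_of_nonneg_right h2.le h3.le
  obtain ⟨Y, hY⟩ := eventually_atTop.1 (hside.and (hP.eventually hloc))
  set E : ℝ → ℝ := fun t => Real.exp (ν / 2 * t) with hE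
  have hEd : ∀ t, HasDerivAt E (ν / 2 * E t) t := fun t => by
    refine (((hasDerivAt_id t).const_mul (ν / 2)).exp).congr_deriv ?_
    simp [hE]; ring
  have hzP : ∀ t, HasDerivAt (fun s => (z s).1) (z t).2 t := fun t => (hz t).fst
  have hzQ : ∀ t, HasDerivAt (fun s => (z s).2) (F (z t).1 - ν * (z t).2) t := fun t => (hz t).snd
  -- The factor e^{νt/2} turns the damped equation into one without first-order term, as Sturm
  -- comparison requires; σ = ±1 selects the side.
  have hv : ∀ t, HasDerivAt (fun t => E t * (σ * ((z t).1 - a)))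
      (E t * (σ * ((z t).2 + ν / 2 * ((z t).1 - a)))) t := fun t => by
    refine ((hEd t).mul (((hzP t).sub_const a).const_mul σ)).congr_deriv ?_
    ring
  have hv₁ : ∀ t, HasDerivAt (fun t => E t * (σ * ((z t).2 + ν / 2 * ((z t).1 - a))))
      (E t * (σ * (F (z t).1 + (ν / 2) ^ 2 * ((z t).1 - a)))) t := fun t => by
    refine ((hEd t).mul (((hzQ t).fun_add (((hzP t).sub_const a).const_mul (ν / 2))).const_mul
      σ)).congr_deriv ?_
    ring
  have hrest : ∀ t, Y ≤ t → (z t).1 = a := fun y hy => by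
    have h := eq_zero_of_sturm (y := y) hδ hv hv₁
      (fun t ht => mul_nonneg (Real.exp_pos _).le (hY t (hy.trans ht)).1) fun t ht => by
        obtain ⟨h1, h2⟩ := hY t (hy.trans ht)
        have hle : σ * F (z t).1 ≤ m * (σ * ((z t).1 - a)) := by
          rcases h1.eq_or_lt with h3 | h3
          · have h4 : (z t).1 - a = 0 := by
              rcases mul_eq_zero.1 h3.symm with h5 | h5
              · rw [h5] at hσ; norm_num at hσ
              · exact h5
            rw [sub_eq_zero.1 h4, hFa]; simp
          · refine le_of_mul_le_mul_right ?_ h3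
            have e1 : σ * F (z t).1 * (σ * ((z t).1 - a)) =
                (σ * σ) * (F (z t).1 * ((z t).1 - a)) := by ring
            have e2 : m * (σ * ((z t).1 - a)) * (σ * ((z t).1 - a)) =
                (σ * σ) * (m * ((z t).1 - a) ^ 2) := by ring
            rw [e1, e2, hσ]
            linarith
        have hEp : 0 < E t := Real.exp_pos _
        have := mul_le_mul_of_nonneg_left hle hEp.le
        rw [hδ2]
        linarith
    rcases mul_eq_zero.1 h with h | h
    · exact absurd h (Real.exp_pos _).ne'
    · rcases mul_eq_zero.1 h with h5 | h5
      · rw [h5] at hσ; norm_num at hσ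
      · exact sub_eq_zero.1 h5
  filter_upwards [eventually_gt_atTop Y] with t ht
  have h1 : HasDerivAt (fun s => (z s).1) 0 t := by
    refine (hasDerivAt_const t a).congr_of_eventuallyEq ?_
    filter_upwards [Ioi_mem_nhds ht] with s hs using hrest s (le_of_lt hs)
  exact Prod.ext (hrest t ht.le) ((hzP t).unique h1)

theorem LipschitzOnWith.dampedField {F : ℝ → ℝ} {K : NNReal} {s : Set ℝ}
    (hF : LipschitzOnWith K F s) (ν : ℝ) :
    ∃ L, LipschitzOnWith L (dampedField F ν) (s ×ˢ univ) := by
  have h2 : LipschitzOnWith (K * 1) (fun z : ℝ × ℝ => F z.1) (s ×ˢ univ) :=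
    hF.comp LipschitzWith.prod_fst.lipschitzOnWith fun z hz => hz.1
  have h3 : LipschitzWith (‖ν‖₊ * 1) (fun z : ℝ × ℝ => ν • z.2) :=
    (lipschitzWith_smul ν).comp LipschitzWith.prod_snd
  refine ⟨_, (LipschitzWith.prod_snd.lipschitzOnWith (s := s ×ˢ univ)).prodMk
    (h2.sub h3.lipschitzOnWith)⟩

/-- An orbit in the half plane `P > 0` which passes through an equilibrium is constant. -/
theorem eq_of_eq_equilibrium {F : ℝ → ℝ} {ν a s : ℝ} {z : ℝ → ℝ × ℝ}
    (hz : ∀ t, HasDerivAt z (dampedField F ν (z t)) t)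
    (hF : ∀ p q, 0 < p → ∃ K, LipschitzOnWith K F (Icc p q)) (hFa : F a = 0)
    (hpos : ∀ t, 0 < (z t).1) (hs : z s = (a, 0)) (t : ℝ) : z t = (a, 0) := by
  have hc : Continuous fun t => (z t).1 :=
    continuous_iff_continuousAt.2 fun t => (hz t).continuousAt.fst
  set l := min s t - 1
  set r := max s t + 1
  have hsm : s ∈ Ioo l r :=
    ⟨by have := min_le_left s t; grind, by have := le_max_left s t; grind⟩
  have htm : t ∈ Ioo l r :=
    ⟨by have := min_le_right s t; grind, by have := le_max_right s t; grind⟩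
  have hne : (Icc l r).Nonempty := ⟨s, Ioo_subset_Icc_self hsm⟩
  -- F need not be Lipschitz near 0, but on a compact time interval P stays between a positive
  -- minimum and a maximum.
  obtain ⟨i, -, hi⟩ := isCompact_Icc.exists_isMinOn hne hc.continuousOn
  obtain ⟨j, -, hj⟩ := isCompact_Icc.exists_isMaxOn hne hc.continuousOn
  obtain ⟨K, hK⟩ := hF (z i).1 (z j).1 (hpos i)
  obtain ⟨L, hL⟩ := hK.dampedField ν
  have hmem : ∀ u ∈ Ioo l r, z u ∈ Icc (z i).1 (z j).1 ×ˢ (univ : Set ℝ) := fun u hu =>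
    ⟨⟨hi (Ioo_subset_Icc_self hu), hj (Ioo_subset_Icc_self hu)⟩, mem_univ _⟩
  have h0 : dampedField F ν (a, 0) = 0 := by simp [_root_.dampedField, hFa]
  exact ODE_solution_unique_of_mem_Ioo (v := fun _ => dampedField F ν)
    (s := fun _ => Icc (z i).1 (z j).1 ×ˢ univ) (g := fun _ => (a, 0)) (fun _ _ => hL) hsm
    (fun u hu => ⟨hz u, hmem u hu⟩)
    (fun u _ => ⟨by rw [h0]; exact hasDerivAt_const u _, hs ▸ hmem s hsm⟩) hs htm

/-- A nonconstant orbit converging to an underdamped equilibrium oscillates around it. -/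
theorem oscillatesAround_of_underdamped {F : ℝ → ℝ} {F' ν a : ℝ} {z : ℝ → ℝ × ℝ}
    (hz : ∀ t, HasDerivAt z (dampedField F ν (z t)) t) (hF : HasDerivAt F F' a) (hFa : F a = 0)
    (hF' : F' < -(ν / 2) ^ 2) (hlim : Tendsto z atTop (𝓝 (a, 0)))
    (hlip : ∀ p q, 0 < p → ∃ K, LipschitzOnWith K F (Icc p q)) (hpos : ∀ t, 0 < (z t).1)
    (hne : ∃ t, z t ≠ (a, 0)) : QHD.OscillatesAround (fun t => (z t).1) a atTop := by
  obtain ⟨t, ht⟩ := hne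
  have key : ∀ σ : ℝ, σ * σ = 1 → ¬ ∀ᶠ t in atTop, 0 ≤ σ * ((z t).1 - a) := fun σ hσ h => by
    obtain ⟨s, hs⟩ := (eventually_eq_of_underdamped hz hF hFa hF' hlim hσ h).exists
    exact ht (eq_of_eq_equilibrium hz hlip hFa hpos hs t)
  refine ⟨fun h => key (-1) (by norm_num) ?_, fun h => key 1 (by norm_num) ?_⟩
  · filter_upwards [h] with t ht using by linarith [not_lt.1 ht]
  · filter_upwards [h] with t ht using by linarith [not_lt.1 ht]

/-- A nondecreasing function never exceeds its limit at +∞ and a nonincreasing one never falls below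
it. -/
theorem nonMonotone_of_oscillatesAround_atTop {g : ℝ → ℝ} {a : ℝ}
    (h : QHD.OscillatesAround g a atTop) (hlim : Tendsto g atTop (𝓝 a)) : QHD.NonMonotone g := by
  refine ⟨fun hm => ?_, fun hm => ?_⟩
  · obtain ⟨t, ht⟩ := h.1.exists
    exact absurd (hm.ge_of_tendsto hlim t) (not_le.2 ht)
  · obtain ⟨t, ht⟩ := h.2.exists
    exact absurd (hm.le_of_tendsto hlim t) (not_le.2 ht)

end Oscillation

/-! ### Infinite potential barrier at P = 0 -/

section Barrier

open Set

/-- A force on `(0, b]` bounded below by `α / x ^ 3 - M` has an infinite potential barrier at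
`0`. -/
theorem exists_integral_nonneg_of_cubic_barrier {F : ℝ → ℝ} {α M a b : ℝ} (hα : 0 < α)
    (ha : 0 < a) (hab : a < b) (hcont : ∀ p, 0 < p → ContinuousOn F (Icc p b))
    (hF : ∀ x ∈ Ioc 0 b, α / x ^ 3 - M ≤ F x) : ∃ c ∈ Ioo 0 a, 0 ≤ ∫ x in c..b, F x := by
  -- An antiderivative of α/x³ - M; it tends to -∞ as x → 0+.
  set Ψ : ℝ → ℝ := fun x => -(α / 2) * (x ^ 2)⁻¹ - M * x with hΨ
  have hd : ∀ x, 0 < x → HasDerivAt Ψ (α / x ^ 3 - M) x := fun x hx => by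
    have h1 := ((hasDerivAt_pow 2 x).inv (by positivity)).const_mul (-(α / 2))
    have h2 := (hasDerivAt_id x).const_mul M
    refine (h1.sub h2).congr_deriv ?_
    field_simp
    push_cast
    ring
  have hlim : Tendsto (fun c => Ψ b - Ψ c) (𝓝[>] 0) atTop := by
    have h1 : Tendsto (fun c : ℝ => (c ^ 2)⁻¹) (𝓝[>] 0) atTop := by
      have := (tendsto_pow_atTop (α := ℝ) (n := 2) (by norm_num)).comp tendsto_inv_nhdsGT_zero
      refine this.congr fun c => ?_
      simp
    have h2 : Tendsto (fun c : ℝ => Ψ b + M * c) (𝓝[>] 0) (𝓝 (Ψ b + M * 0)) :=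
      ((by fun_prop : Continuous fun c : ℝ => Ψ b + M * c).tendsto 0).mono_left nhdsWithin_le_nhds
    refine ((h1.const_mul_atTop (half_pos hα)).atTop_add h2).congr fun c => ?_
    simp only [hΨ]
    ring
  obtain ⟨c, h1, hc⟩ := ((hlim.eventually_ge_atTop 0).and (Ioo_mem_nhdsGT ha)).exists
  refine ⟨c, hc, h1.trans ?_⟩
  have hcb : c ≤ b := (hc.2.trans hab).le
  have hc' : ContinuousOn (fun x : ℝ => α / x ^ 3 - M) (Icc c b) := by
    refine ContinuousOn.sub (ContinuousOn.div continuousOn_const (by fun_prop) fun x hx => ?_)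
      continuousOn_const
    have := hc.1.trans_le hx.1
    positivity
  rw [← uIcc_of_le hcb] at hc'
  have hFc := hcont c hc.1
  rw [← uIcc_of_le hcb] at hFc
  rw [← intervalIntegral.integral_eq_sub_of_hasDerivAt (f' := fun x => α / x ^ 3 - M)
    (fun x hx => hd x ?_) hc'.intervalIntegrable]
  · exact intervalIntegral.integral_mono_on hcb hc'.intervalIntegrable hFc.intervalIntegrable
      fun x hx => hF x ⟨hc.1.trans_le hx.1, hx.2⟩
  · rw [uIcc_of_le hcb] at hx
    exact hc.1.trans_le hx.1

/-- The connection from the saddle to the bottom of the well for a force on `(0, ∞)` with an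
infinite potential barrier at `0`. -/
theorem exists_connection_of_cubic_barrier {F : ℝ → ℝ} {α M a b ν : ℝ} (hν : 0 < ν) (hα : 0 < α)
    (ha : 0 < a) (hab : a < b) (hlip : ∀ p q, 0 < p → ∃ K, LipschitzOnWith K F (Icc p q))
    (hFa : F a = 0) (hFb : F b = 0) (hneg : ∀ x ∈ Ioo a b, F x < 0)
    (hpos : ∀ x ∈ Ioo 0 a, 0 < F x) (hF : ∀ x ∈ Ioc 0 b, α / x ^ 3 - M ≤ F x) :
    ∃ z : ℝ → ℝ × ℝ, (∀ t, HasDerivAt z (dampedField F ν (z t)) t) ∧ (∀ t, 0 < (z t).1) ∧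
      Tendsto z atBot (𝓝 (b, 0)) ∧ Tendsto z atTop (𝓝 (a, 0)) := by
  obtain ⟨c, hc, hint⟩ := exists_integral_nonneg_of_cubic_barrier hα ha hab
    (fun p hp => (hlip p b hp).choose_spec.continuousOn) hF
  have hcb : c ≤ b := (hc.2.trans hab).le
  obtain ⟨K, hK⟩ := hlip c b hc.1
  -- Freezing F outside [c, b] gives a globally Lipschitz force, zero beyond b. The connection found
  -- for G stays in [c, b], where G = F.
  set G : ℝ → ℝ := fun x => F (projIcc c b hcb x) with hG
  have hGF : ∀ x ∈ Icc c b, G x = F x := fun x hx => by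
    simp only [hG, projIcc_of_mem hcb hx]
  have hGb : ∀ x, b ≤ x → G x = 0 := fun x hx => by
    simp only [hG, projIcc_of_right_le hcb hx, hFb]
  have hGlip : LipschitzWith (K * 1) G :=
    (lipschitzOnWith_iff_restrict.1 hK).comp (LipschitzWith.projIcc hcb)
  obtain ⟨z, hz, hmem, h1, h2⟩ := exists_connection_dampedField hGlip hν hc.2 hab (hGb b le_rfl)
    (fun x hx => (hGF x ⟨(hc.2.trans hx.1).le, hx.2.le⟩).symm ▸ hneg x hx)
    (fun x hx => by
      rcases hx.eq_or_lt with h | h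
      · rw [← h, hGF a ⟨hc.2.le, hab.le⟩, hFa]
      · rcases lt_or_ge x b with h' | h'
        · rw [hGF x ⟨(hc.2.trans h).le, h'.le⟩]
          exact (hneg x ⟨h, h'⟩).le
        · exact (hGb x h').le)
    (fun x hx => by
      rw [hGF x ⟨hx.1, (hx.2.trans hab).le⟩]
      exact hpos x ⟨hc.1.trans_le hx.1, hx.2⟩)
    (by
      rw [potential, intervalIntegral.integral_congr (g := F) fun x hx => ?_]
      · exact hint
      · rw [uIcc_of_le hcb] at hx
        exact hGF x hx)
  refine ⟨z, fun t => ?_, fun t => hc.1.trans_le (hmem t).1, h1, h2⟩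
  have := hz t
  rwa [dampedField, hGF _ (hmem t)] at this

end Barrier

/-! ### Sign, growth and regularity of f -/

namespace QHD

section Force

open Set

theorem f_endState {γ s P₀ u₀ : ℝ} (hP : 0 < P₀) : f γ s P₀ u₀ P₀ = 0 := by
  unfold f constA constB
  field_simp
  ring

theorem RankineHugoniot.f_eq {γ s Pm um Pp up : ℝ} (h : RankineHugoniot γ s Pm um Pp up) :
    f γ s Pm um = f γ s Pp up := by
  funext P
  rw [f, f, h.constA_eq, h.constB_eq]

theorem enthalpy_exp (γ x : ℝ) : enthalpy γ (Real.exp x) =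
    if γ = 1 then x else γ / (γ - 1) * Real.exp ((γ - 1) * x) := by
  unfold enthalpy
  split_ifs with h
  · exact Real.log_exp x
  · rw [← Real.exp_mul, mul_comm x]

theorem strictConvexOn_exp_mul {c : ℝ} (hc : c ≠ 0) :
    StrictConvexOn ℝ univ fun x => Real.exp (c * x) := by
  refine ⟨convex_univ, fun x _ y _ hxy r q hr hq hrq => ?_⟩
  have := strictConvexOn_exp.2 (mem_univ (c * x)) (mem_univ (c * y))
    (fun h => hxy (mul_left_cancel₀ hc h)) hr hq hrq
  simp only [smul_eq_mul] at this ⊢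
  rwa [show c * (r * x + q * y) = r * (c * x) + q * (c * y) by ring]

/-- In the logarithmic variable h is linear or a positive multiple of an exponential, even where h
itself is concave in ρ. -/
theorem convexOn_enthalpy_exp {γ : ℝ} (hγ : 1 ≤ γ) :
    ConvexOn ℝ univ fun x => enthalpy γ (Real.exp (2 * x)) := by
  simp only [enthalpy_exp]
  split_ifs with h
  · exact ((LinearMap.mulLeft ℝ (2 : ℝ)).convexOn convex_univ)
  · have h1 : 0 < γ - 1 := sub_pos.2 (lt_of_le_of_ne hγ (Ne.symm h))
    have := (strictConvexOn_exp_mul (c := (γ - 1) * 2) (by positivity)).convexOn.smul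
      (show 0 ≤ γ / (γ - 1) by positivity)
    simpa only [smul_eq_mul, Pi.smul_apply, mul_assoc] using! this

theorem enthalpy_lt_enthalpy {γ x y : ℝ} (hγ : 1 ≤ γ) (hx : 0 < x) (hxy : x < y) :
    enthalpy γ x < enthalpy γ y := by
  unfold enthalpy
  split_ifs with h
  · exact Real.log_lt_log hx hxy
  · have h1 : 0 < γ - 1 := sub_pos.2 (lt_of_le_of_ne hγ (Ne.symm h))
    have := Real.rpow_lt_rpow hx.le hxy h1
    have h2 : 0 < γ / (γ - 1) := by positivity
    exact mul_lt_mul_of_pos_left this h2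

/-- Only γ = 1 matters, h being positive otherwise: log P ≥ 1 - 1/P gives 2P log P ≥ 2P - 2. -/
theorem neg_two_le_enthalpy_mul {γ P : ℝ} (hγ : 1 ≤ γ) (hP : 0 < P) :
    -2 ≤ enthalpy γ (P ^ 2) * P := by
  unfold enthalpy
  split_ifs with h
  · have h1 := Real.one_sub_inv_le_log_of_pos hP
    have h2 := mul_le_mul_of_nonneg_right h1 hP.le
    rw [sub_mul, inv_mul_cancel₀ hP.ne', one_mul] at h2
    rw [Real.log_pow]
    push_cast
    linarith
  · have h1 : 0 < γ - 1 := sub_pos.2 (lt_of_le_of_ne hγ (Ne.symm h))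
    have : 0 ≤ γ / (γ - 1) * (P ^ 2) ^ (γ - 1) * P := by positivity
    linarith

/-- A strictly convex function with two zeros is negative between them and positive before the
first one. -/
theorem _root_.StrictConvexOn.sign_of_zeros {g : ℝ → ℝ} (hg : StrictConvexOn ℝ univ g) {α β : ℝ}
    (hαβ : α < β) (hα : g α = 0) (hβ : g β = 0) :
    (∀ x ∈ Ioo α β, g x < 0) ∧ ∀ x, x < α → 0 < g x := by
  refine ⟨fun x hx => ?_, fun x hx => ?_⟩
  · have := hg.lt_on_openSegment (mem_univ α) (mem_univ β) hαβ.ne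
      (by rwa [openSegment_eq_Ioo hαβ] : x ∈ openSegment ℝ α β)
    simpa [hα, hβ] using this
  · by_contra hcon
    have := hg.lt_on_openSegment (mem_univ x) (mem_univ β) (hx.trans hαβ).ne
      (by rw [openSegment_eq_Ioo (hx.trans hαβ)]; exact ⟨hx, hαβ⟩ : α ∈ openSegment ℝ x β)
    rw [hα, hβ, max_eq_right (not_lt.1 hcon)] at this
    exact lt_irrefl _ this

variable {γ s P₀ u₀ a b : ℝ}

/-- With A = 0, f(P)/P would be h(P²) plus a constant, which is strictly increasing and cannot
vanish twice. -/
theorem constA_ne_zero (hγ : 1 ≤ γ) (ha : 0 < a) (hab : a < b) (hfa : f γ s P₀ u₀ a = 0)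
    (hfb : f γ s P₀ u₀ b = 0) : constA s P₀ u₀ ≠ 0 := by
  intro hA
  have hb := ha.trans hab
  have h := enthalpy_lt_enthalpy hγ (by positivity : 0 < a ^ 2) (by gcongr : a ^ 2 < b ^ 2)
  have h1 := (mul_eq_zero.1 hfa).resolve_right ha.ne'
  have h2 := (mul_eq_zero.1 hfb).resolve_right hb.ne'
  rw [hA] at h1 h2
  simp only [ne_eq, OfNat.ofNat_ne_zero, not_false_eq_true, zero_pow, zero_div] at h1 h2
  linarith

/-- In the variable log P, f(P)/P is the strictly convex A²/2 · e^{-4x}, plus the convex enthalpy,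
plus a constant. -/
theorem f_sign (hγ : 1 ≤ γ) (ha : 0 < a) (hab : a < b) (hfa : f γ s P₀ u₀ a = 0)
    (hfb : f γ s P₀ u₀ b = 0) :
    (∀ x ∈ Ioo a b, f γ s P₀ u₀ x < 0) ∧ ∀ x ∈ Ioo 0 a, 0 < f γ s P₀ u₀ x := by
  have hA := constA_ne_zero hγ ha hab hfa hfb
  have hb := ha.trans hab
  set g : ℝ → ℝ := fun x => constA s P₀ u₀ ^ 2 / 2 * Real.exp (-4 * x) +
    enthalpy γ (Real.exp (2 * x)) + (constB γ s P₀ u₀ - s ^ 2 / 2) with hg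
  have hgc : StrictConvexOn ℝ univ g := by
    have h1 : StrictConvexOn ℝ univ fun x => constA s P₀ u₀ ^ 2 / 2 * Real.exp (-4 * x) := by
      have h2 := strictConvexOn_exp_mul (c := -4) (by norm_num)
      have h3 : 0 < constA s P₀ u₀ ^ 2 / 2 := by positivity
      refine ⟨convex_univ, fun x hx y hy hxy r q hr hq hrq => ?_⟩
      have := mul_lt_mul_of_pos_left (h2.2 hx hy hxy hr hq hrq) h3
      simp only [smul_eq_mul] at this ⊢
      linarith
    exact (h1.add_convexOn (convexOn_enthalpy_exp hγ)).add_const _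
  have hfg : ∀ x, 0 < x → f γ s P₀ u₀ x = g (Real.log x) * x := fun x hx => by
    have e1 : Real.exp (2 * Real.log x) = x ^ 2 := by
      rw [show 2 * Real.log x = Real.log (x ^ 2) by rw [Real.log_pow]; norm_num,
        Real.exp_log (by positivity)]
    have e2 : Real.exp (-4 * Real.log x) = (x ^ 4)⁻¹ := by
      rw [show -4 * Real.log x = -Real.log (x ^ 4) by rw [Real.log_pow]; push_cast; ring,
        Real.exp_neg, Real.exp_log (by positivity)]
    simp only [hg, e1, e2, f]
    ring
  rw [hfg a ha] at hfa
  rw [hfg b hb] at hfb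
  obtain ⟨h1, h2⟩ := hgc.sign_of_zeros (Real.log_lt_log ha hab)
    ((mul_eq_zero.1 hfa).resolve_right ha.ne') ((mul_eq_zero.1 hfb).resolve_right hb.ne')
  refine ⟨fun x hx => ?_, fun x hx => ?_⟩
  · have hx0 := ha.trans hx.1
    rw [hfg x hx0]
    exact mul_neg_of_neg_of_pos (h1 _ ⟨Real.log_lt_log ha hx.1, Real.log_lt_log hx0 hx.2⟩) hx0
  · rw [hfg x hx.1]
    exact mul_pos (h2 _ (Real.log_lt_log hx.1 hx.2)) hx.1

theorem le_f (hγ : 1 ≤ γ) {x : ℝ} (hx : x ∈ Ioc 0 b) :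
    constA s P₀ u₀ ^ 2 / 2 / x ^ 3 - (2 + |constB γ s P₀ u₀ - s ^ 2 / 2| * b) ≤
      f γ s P₀ u₀ x := by
  have h1 := neg_two_le_enthalpy_mul hγ hx.1
  have h2 : -(|constB γ s P₀ u₀ - s ^ 2 / 2| * b) ≤ (constB γ s P₀ u₀ - s ^ 2 / 2) * x := by
    have h3 := mul_le_mul_of_nonneg_left hx.2 (abs_nonneg (constB γ s P₀ u₀ - s ^ 2 / 2))
    have h4 := mul_le_mul_of_nonneg_right (neg_abs_le (constB γ s P₀ u₀ - s ^ 2 / 2)) hx.1.le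
    linarith
  have h5 : f γ s P₀ u₀ x = constA s P₀ u₀ ^ 2 / 2 / x ^ 3 + enthalpy γ (x ^ 2) * x +
      (constB γ s P₀ u₀ - s ^ 2 / 2) * x := by
    have := hx.1.ne'
    unfold f
    field_simp
    ring
  linarith

theorem contDiffOn_f (γ s P₀ u₀ : ℝ) : ContDiffOn ℝ 1 (f γ s P₀ u₀) (Ioi 0) := by
  have h : ContDiffOn ℝ 1 (fun P : ℝ => enthalpy γ (P ^ 2)) (Ioi 0) := by
    intro x hx
    have hx2 : x ^ 2 ≠ 0 := pow_ne_zero 2 (ne_of_gt hx)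
    unfold enthalpy
    split_ifs
    · exact ((contDiffAt_id.pow 2).log hx2).contDiffWithinAt
    · exact (contDiffAt_const.mul
        ((contDiffAt_id.pow 2).rpow_const_of_ne hx2)).contDiffWithinAt
  have h' : ContDiffOn ℝ 1 (fun P : ℝ => constA s P₀ u₀ ^ 2 / P ^ 4) (Ioi 0) :=
    contDiffOn_const.div (contDiffOn_id.pow 4) fun x hx => pow_ne_zero 4 (ne_of_gt hx)
  unfold f
  exact ((((h'.sub contDiffOn_const).div_const 2).add h).add contDiffOn_const).mul contDiffOn_id

end Force

end QHD

/-! ### Time reversal -/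

/-- Time reversal turns damping into excitation. -/
theorem HasDerivAt.dampedField_reverse {F : ℝ → ℝ} {ν ν' : ℝ} (hν : ν' = -ν) {z : ℝ → ℝ × ℝ}
    (hz : ∀ t, HasDerivAt z (dampedField F ν (z t)) t) (t : ℝ) :
    HasDerivAt (fun s => ((z (-s)).1, -(z (-s)).2))
      (dampedField F ν' ((z (-t)).1, -(z (-t)).2)) t := by
  have h1 : HasDerivAt (fun s => (z s).1) (z (-t)).2 (-t) := (hz (-t)).fst
  have h2 : HasDerivAt (fun s => (z s).2) (F (z (-t)).1 - ν * (z (-t)).2) (-t) := (hz (-t)).snd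
  have h3 := h1.comp t (hasDerivAt_neg t)
  have h4 := (h2.comp t (hasDerivAt_neg t)).neg
  refine (h3.prodMk h4).congr_deriv ?_
  simp only [dampedField, hν, Prod.mk.injEq]
  constructor <;> ring

theorem tendsto_reverse_orbit {z : ℝ → ℝ × ℝ} {l l' : Filter ℝ} {a : ℝ}
    (hl : Tendsto (fun t : ℝ => -t) l l') (h : Tendsto z l' (𝓝 (a, 0))) :
    Tendsto (fun t => ((z (-t)).1, -(z (-t)).2)) l (𝓝 (a, 0)) := by
  have h1 := h.comp hl
  have := h1.fst_nhds.prodMk_nhds h1.snd_nhds.neg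
  simpa using this

/-! ### Application to the profile force f/k² -/

namespace QHD

section Connection

open Set

variable {γ s P₀ u₀ k a b : ℝ}

theorem exists_lipschitzOnWith_force (γ s P₀ u₀ k p q : ℝ) (hp : 0 < p) :
    ∃ K, LipschitzOnWith K (fun x => f γ s P₀ u₀ x / k ^ 2) (Icc p q) := by
  have h : ContDiffOn ℝ 1 (fun x => f γ s P₀ u₀ x / k ^ 2) (Icc p q) :=
    ((contDiffOn_f γ s P₀ u₀).div_const _).mono fun x hx => hp.trans_le hx.1
  exact h.exists_lipschitzOnWith one_ne_zero (convex_Icc _ _) isCompact_Icc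

theorem exists_connection_force (hγ : 1 ≤ γ) (hk : 0 < k) (ha : 0 < a) (hab : a < b)
    (hfa : f γ s P₀ u₀ a = 0) (hfb : f γ s P₀ u₀ b = 0) {ν : ℝ} (hν : 0 < ν) :
    ∃ z : ℝ → ℝ × ℝ, (∀ t, HasDerivAt z (dampedField (fun x => f γ s P₀ u₀ x / k ^ 2) ν (z t)) t) ∧
      (∀ t, 0 < (z t).1) ∧ Tendsto z atBot (𝓝 (b, 0)) ∧ Tendsto z atTop (𝓝 (a, 0)) := by
  have hA := constA_ne_zero hγ ha hab hfa hfb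
  have hk2 : 0 < k ^ 2 := by positivity
  obtain ⟨hneg, hpos⟩ := f_sign hγ ha hab hfa hfb
  refine exists_connection_of_cubic_barrier (α := constA s P₀ u₀ ^ 2 / 2 / k ^ 2)
    (M := (2 + |constB γ s P₀ u₀ - s ^ 2 / 2| * b) / k ^ 2) hν (by positivity) ha hab
    (fun p q hp => exists_lipschitzOnWith_force γ s P₀ u₀ k p q hp) (by simp [hfa]) (by simp [hfb])
    (fun x hx => div_neg_of_neg_of_pos (hneg x hx) hk2) (fun x hx => div_pos (hpos x hx) hk2)
    fun x hx => ?_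
  have := div_le_div_of_nonneg_right (le_f (s := s) (P₀ := P₀) (u₀ := u₀) hγ hx) hk2.le
  rwa [sub_div, div_right_comm _ (x ^ 3)] at this

theorem oscillatesAround_force (hk : 0 < k) (ha : 0 < a) (hfa : f γ s P₀ u₀ a = 0) {ν : ℝ}
    (hν : 0 < ν) (hunder : ν / 2 * k < √(-deriv (f γ s P₀ u₀) a)) {z : ℝ → ℝ × ℝ}
    (hz : ∀ t, HasDerivAt z (dampedField (fun x => f γ s P₀ u₀ x / k ^ 2) ν (z t)) t)
    (hpos : ∀ t, 0 < (z t).1) (hlim : Tendsto z atTop (𝓝 (a, 0))) (hne : ∃ t, z t ≠ (a, 0)) :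
    OscillatesAround (fun t => (z t).1) a atTop := by
  have hd : HasDerivAt (f γ s P₀ u₀) (deriv (f γ s P₀ u₀) a) a :=
    (((contDiffOn_f γ s P₀ u₀).contDiffAt (Ioi_mem_nhds ha)).differentiableAt
      one_ne_zero).hasDerivAt
  refine oscillatesAround_of_underdamped hz (hd.div_const (k ^ 2)) (by simp [hfa]) ?_ hlim
    (fun p q hp => exists_lipschitzOnWith_force γ s P₀ u₀ k p q hp) hpos hne
  -- Squaring gives (ν/2)² k² < -f'(a): the linearization at (a, 0) has non-real eigenvalues.
  have h := (Real.lt_sqrt (by positivity)).1 hunder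
  rw [div_lt_iff₀ (by positivity)]
  nlinarith

theorem exists_ne_of_tendsto_ne {z : ℝ → ℝ × ℝ} {p q : ℝ × ℝ} {l : Filter ℝ} [l.NeBot]
    (hpq : p ≠ q) (h : Tendsto z l (𝓝 p)) : ∃ t, z t ≠ q :=
  (h.eventually_ne hpq).exists

end Connection

end QHD

/-! ### The two cases of the theorem -/

theorem lemma3p1 (γ μ k : ℝ) (hγ : 1 ≤ γ) (hμ : 0 < μ) (hk : 0 < k)
    (s Pm um Pp up : ℝ) (hRH : QHD.RankineHugoniot γ s Pm um Pp up) :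
    ((0 < s → 0 < Pp → Pp < Pm →
        (∃ z : ℝ → ℝ × ℝ, QHD.IsHeteroclinicProfile γ μ k s Pm um Pp z) ∧
        (s * μ / k < Real.sqrt (-deriv (QHD.f γ s Pm um) Pp) →
          ∀ z : ℝ → ℝ × ℝ, QHD.IsHeteroclinicProfile γ μ k s Pm um Pp z →
            QHD.NonMonotone (fun y => (z y).1) ∧
            QHD.OscillatesAround (fun y => (z y).1) Pp atTop)) ∧
      (s < 0 → 0 < Pm → Pm < Pp →
        (∃ z : ℝ → ℝ × ℝ, QHD.IsHeteroclinicProfile γ μ k s Pm um Pp z) ∧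
        (-(s * μ / k) < Real.sqrt (-deriv (QHD.f γ s Pm um) Pm) →
          ∀ z : ℝ → ℝ × ℝ, QHD.IsHeteroclinicProfile γ μ k s Pm um Pp z →
            QHD.NonMonotone (fun y => (z y).1) ∧
            QHD.OscillatesAround (fun y => (z y).1) Pm atBot))) := by
  have hzero : 0 < Pm → 0 < Pp → QHD.f γ s Pm um Pm = 0 ∧ QHD.f γ s Pm um Pp = 0 :=
    fun hm hp => ⟨QHD.f_endState hm, by rw [hRH.f_eq]; exact QHD.f_endState hp⟩
  have heq : ∀ x, QHD.f γ s Pm um x = 0 → QHD.profileField γ μ k s Pm um (x, 0) = 0 := fun x hx => by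
    simp [QHD.profileField, hx]
  constructor
  · intro hs hp hpm
    obtain ⟨hfm, hfp⟩ := hzero (hp.trans hpm) hp
    have hν : 0 < 2 * s * μ / k ^ 2 := by positivity
    constructor
    · obtain ⟨z, hz, hpos, hbot, htop⟩ := QHD.exists_connection_force hγ hk hp hpm hfp hfm hν
      exact ⟨z, fun h => hpm.ne' (congrArg Prod.fst h), hp.trans hpm, hp, heq _ hfm, heq _ hfp,
        hpos, hz, hbot, htop⟩
    · intro hunder z hz
      have hosc := QHD.oscillatesAround_force hk hp hfp hν
        (by convert hunder using 1; field_simp) hz.hasDerivAt hz.mem hz.tendsto_right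
        (QHD.exists_ne_of_tendsto_ne hz.ne hz.tendsto_left)
      exact ⟨nonMonotone_of_oscillatesAround_atTop hosc hz.tendsto_right.fst_nhds, hosc⟩
  · intro hs hm hmp
    obtain ⟨hfm, hfp⟩ := hzero hm (hm.trans hmp)
    have hν : 0 < -(2 * s * μ / k ^ 2) := by
      have : 0 < 2 * (-s) * μ / k ^ 2 := by
        have := neg_pos.2 hs
        positivity
      linarith [show 2 * (-s) * μ / k ^ 2 = -(2 * s * μ / k ^ 2) by ring]
    constructor
    · obtain ⟨z, hz, hpos, hbot, htop⟩ := QHD.exists_connection_force hγ hk hm hmp hfm hfp hν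
      -- With damping -2sμ/k² > 0 the connection runs from the larger state `Pp` to `Pm`; reversing
      -- time restores the original system and direction.
      exact ⟨fun t => ((z (-t)).1, -(z (-t)).2), fun h => hmp.ne (congrArg Prod.fst h), hm,
        hm.trans hmp, heq _ hfm, heq _ hfp,
        fun t => hpos (-t), HasDerivAt.dampedField_reverse (neg_neg _).symm hz,
        tendsto_reverse_orbit tendsto_neg_atBot_atTop htop,
        tendsto_reverse_orbit tendsto_neg_atTop_atBot hbot⟩
    · intro hunder z hz
      have hlim := tendsto_reverse_orbit tendsto_neg_atTop_atBot hz.tendsto_left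
      have hosc := QHD.oscillatesAround_force hk hm hfm hν
        (by convert hunder using 1; field_simp) (HasDerivAt.dampedField_reverse rfl hz.hasDerivAt)
        (fun t => hz.mem (-t)) hlim
        (QHD.exists_ne_of_tendsto_ne hz.ne.symm
          (tendsto_reverse_orbit tendsto_neg_atBot_atTop hz.tendsto_right))
      obtain ⟨h1, h2⟩ := nonMonotone_of_oscillatesAround_atTop hosc hlim.fst_nhds
      -- Reflection in time exchanges nondecreasing and nonincreasing.
      refine ⟨⟨fun h => h2 fun x y hxy => h (neg_le_neg hxy),
        fun h => h1 fun x y hxy => h (neg_le_neg hxy)⟩, ?_, ?_⟩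
      · simpa using tendsto_neg_atTop_atBot.frequently hosc.1
      · simpa using tendsto_neg_atTop_atBot.frequently hosc.2
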